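/- Let $n \ge 3$ and let $G = (\mathbb{Z}/n, \omega)$, $\omega : \mathbb{Z}/n \times \mathbb{Z}/n \to [0,\infty]$, be a weighted cycle graph: for every $i$ exactly one of $\omega(i,i+1)$, $\omega(i+1,i)$ is finite, and $\omega(i,j) = \infty$ whenever $i \ne j$ and $j \ne i \pm 1$ (loops are irrelevant). Assume that $G$ is inconsistently oriented: it is not true that all edges point from $i$ to $i+1$, nor that all edges point from $i+1$ to $i$. Let $w = \max_i \min\{\omega(i,i+1), \omega(i+1,i)\} < \infty$ be the largest edge weight. Let $d(x,y) \in [0,\infty]$ be the infimum of the weights $\sum_{j<m} \omega(x_j,x_{j+1})$ of the paths $x = x_0, \dots, x_m = y$ ($m \ge 0$), and let $P(G) = (\mathbb{Z}/n, d)$ be the path completion of $G$. A source dominating set of $P(G)$ is a set $K$ of vertices such that every vertex $x$ has $d(k,x) < \infty$ for some $k \in K$; it is minimal if no proper subset is a source dominating set. For $\delta \in [0,\infty)$ let $\mathfrak{D}_\delta(G)$ be the Dowker source complex: the simplicial complex whose simplices are the nonempty sets $\sigma$ of vertices for which there is a vertex $y$ with $d(y,x) \le \delta$ for all $x \in \sigma$.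 Suppose that $P(G)$ has a minimal source dominating set $K$ with $|K| \ge 3$. Then, for every commutative ring $R$ of coefficients and all real $\delta, \delta' \ge 0$: 1. if $\delta \ge w$, then $H_1(\mathfrak{D}_\delta(G); R) \cong R$ as an $R$-module; 2. if $\delta < w$, then $H_1(\mathfrak{D}_\delta(G); R) = 0$; 3. if $w \le \delta \le \delta'$, then the map $H_1(\mathfrak{D}_\delta(G); R) \to H_1(\mathfrak{D}_{\delta'}(G); R)$ induced by inclusion is an isomorphism, so that the class born at $w$ never dies. -/

import Mathlib

open scoped ENNReal NNReal

noncomputable section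

/-! ### Weighted digraphs, path completion, dominating sets -/

/-- A network (weighted digraph) on the vertex set `X`: a function giving each ordered pair of
vertices a weight in `[0, ∞]`; the weight `∞` means that there is no edge. -/
abbrev Network (X : Type*) := X → X → ℝ≥0∞

namespace Network

variable {X : Type*}

/-- The weight of the path `p 0, p 1, …, p m`; it is `0` for a constant path (`m = 0`). -/
def pathWeight (ω : Network X) {m : ℕ} (p : Fin (m + 1) → X) : ℝ≥0∞ :=
  ∑ i : Fin m, ω (p i.castSucc) (p i.succ)

/-- The path completion: the weight of `(x, y)` is the infimum of the weights of all paths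
from `x` to `y`. -/
def pathCompletion (ω : Network X) : Network X := fun x y =>
  ⨅ (m : ℕ) (p : Fin (m + 1) → X) (_ : p 0 = x) (_ : p (Fin.last m) = y), ω.pathWeight p

/-- `K` is a source dominating set: every vertex is reached with finite weight by some element
of `K`. -/
def IsSourceDominating (ω : Network X) (K : Set X) : Prop :=
  ∀ x, ∃ k ∈ K, ω k x < ∞

/-- A source dominating set no proper subset of which is source dominating. -/
def IsMinimalSourceDominating (ω : Network X) (K : Set X) : Prop :=
  Minimal ω.IsSourceDominating K

end Network

/-! ### Dowker complexes -/

/-- The Dowker source complex of a relation `R`: the vertices are the elements of `X`, and a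
nonempty finite `σ ⊆ X` is a simplex when some `y` is related to all elements of `σ`. -/
def dowkerComplex {X Y : Type*} (R : X → Y → Prop) : PreAbstractSimplicialComplex X where
  faces := {σ | σ.Nonempty ∧ ∃ y, ∀ x ∈ σ, R x y}
  isRelLowerSet_faces := by
    rintro σ ⟨hσ, y, hy⟩
    exact ⟨hσ, fun τ hτ hne => ⟨hne, y, fun x hx => hy x (hτ hx)⟩⟩

/-- The Dowker source filtration of a network at `δ`, formed on the path completion `d`:
`σ` is a simplex when some vertex `y` has `d y x ≤ δ` for all `x ∈ σ`. -/
def dowkerFiltration {X : Type*} (ω : Network X) (δ : ℝ≥0) : PreAbstractSimplicialComplex X :=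
  dowkerComplex fun x y => ω.pathCompletion y x ≤ δ

theorem dowkerFiltration_mono {X : Type*} (ω : Network X) : Monotone (dowkerFiltration ω) := by
  rintro δ δ' h σ ⟨hσ, y, hy⟩
  exact ⟨hσ, y, fun x hx => (hy x hx).trans (ENNReal.coe_le_coe.2 h)⟩

/-! ### Simplicial homology, through the ordered chain complex -/

namespace SimplicialChains

variable {X : Type*}

/-- Ordered `n`-simplices of `K`: tuples `(v 0, …, v n)` of vertices, repetitions allowed, that
all lie in one face of `K` (equivalently, whose set of entries is a face). -/
def OrderedSimplex (K : PreAbstractSimplicialComplex X) (n : ℕ) : Type _ :=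
  {v : Fin (n + 1) → X // ∃ σ ∈ K, ∀ i, v i ∈ σ}

/-- The `i`-th face of an ordered simplex: the `i`-th entry is left out. -/
def OrderedSimplex.face {K : PreAbstractSimplicialComplex X} {n : ℕ}
    (v : OrderedSimplex K (n + 1)) (i : Fin (n + 2)) : OrderedSimplex K n :=
  ⟨fun j => v.1 (i.succAbove j), by
    obtain ⟨σ, hσ, hv⟩ := v.2
    exact ⟨σ, hσ, fun j => hv _⟩⟩

/-- An ordered simplex of a subcomplex as an ordered simplex of the larger complex. -/
def OrderedSimplex.incl {K L : PreAbstractSimplicialComplex X} (h : K ≤ L) {n : ℕ}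
    (v : OrderedSimplex K n) : OrderedSimplex L n :=
  ⟨v.1, by
    obtain ⟨σ, hσ, hv⟩ := v.2
    exact ⟨σ, h hσ, hv⟩⟩

variable (R : Type*) [CommRing R]

/-- The `n`-chains of `K` with coefficients in `R`. -/
def Chains (K : PreAbstractSimplicialComplex X) (n : ℕ) : Type _ := OrderedSimplex K n →₀ R

instance (K : PreAbstractSimplicialComplex X) (n : ℕ) : AddCommGroup (Chains R K n) :=
  inferInstanceAs (AddCommGroup (OrderedSimplex K n →₀ R))

instance (K : PreAbstractSimplicialComplex X) (n : ℕ) : Module R (Chains R K n) :=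
  inferInstanceAs (Module R (OrderedSimplex K n →₀ R))

/-- An ordered simplex as a basis element of the chains. -/
def simplexChain {K : PreAbstractSimplicialComplex X} {n : ℕ} (v : OrderedSimplex K n) :
    Chains R K n :=
  Finsupp.single v (1 : R)

theorem chains_hom_ext {K : PreAbstractSimplicialComplex X} {n : ℕ} {M : Type*}
    [AddCommGroup M] [Module R M] {f g : Chains R K n →ₗ[R] M}
    (h : ∀ v, f (simplexChain R v) = g (simplexChain R v)) : f = g :=
  Finsupp.lhom_ext' (R := R) (M := R) fun v => LinearMap.ext_ring (h v)

/-- The linear map on chains with prescribed values on ordered simplices. -/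
def chainLift {K : PreAbstractSimplicialComplex X} {n : ℕ} {M : Type*} [AddCommGroup M]
    [Module R M] (f : OrderedSimplex K n → M) : Chains R K n →ₗ[R] M :=
  Finsupp.linearCombination R f

theorem chainLift_simplexChain {K : PreAbstractSimplicialComplex X} {n : ℕ} {M : Type*}
    [AddCommGroup M] [Module R M] (f : OrderedSimplex K n → M) (v : OrderedSimplex K n) :
    chainLift R f (simplexChain R v) = f v :=
  (Finsupp.linearCombination_single R (1 : R) v).trans (one_smul R (f v))

/-- The boundary `∂ (v 0, …, v (n+1)) = ∑ i, (-1) ^ i (v 0, …, omit v i, …, v (n+1))`. -/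
def boundary (K : PreAbstractSimplicialComplex X) (n : ℕ) :
    Chains R K (n + 1) →ₗ[R] Chains R K n :=
  chainLift R fun v => ∑ i : Fin (n + 2), (-1 : R) ^ (i : ℕ) • simplexChain R (v.face i)

/-- The map of chains induced by the inclusion of a subcomplex. -/
def chainMap {K L : PreAbstractSimplicialComplex X} (h : K ≤ L) (n : ℕ) :
    Chains R K n →ₗ[R] Chains R L n :=
  chainLift R fun v => simplexChain R (v.incl h)

theorem boundary_chainMap {K L : PreAbstractSimplicialComplex X} (h : K ≤ L) (n : ℕ)
    (c : Chains R K (n + 1)) :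
    boundary R L n (chainMap R h (n + 1) c) = chainMap R h n (boundary R K n c) := by
  suffices H : boundary R L n ∘ₗ chainMap R h (n + 1) = chainMap R h n ∘ₗ boundary R K n from
    LinearMap.congr_fun H c
  refine chains_hom_ext R fun v => ?_
  simp only [boundary, chainMap, LinearMap.comp_apply, chainLift_simplexChain, map_sum,
    map_smul]
  rfl

/-- The 1-cycles. -/
abbrev oneCycles (K : PreAbstractSimplicialComplex X) : Submodule R (Chains R K 1) :=
  LinearMap.ker (boundary R K 0)

/-- The 1-boundaries, as a submodule of the 1-cycles. -/
abbrev oneBoundaries (K : PreAbstractSimplicialComplex X) : Submodule R (oneCycles R K) :=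
  (LinearMap.range (boundary R K 1)).submoduleOf (oneCycles R K)

/-- The first simplicial homology of `K` with coefficients in `R`. -/
abbrev H₁ (K : PreAbstractSimplicialComplex X) := oneCycles R K ⧸ oneBoundaries R K

/-- The map on first homology induced by the inclusion of a subcomplex. -/
def H₁map {K L : PreAbstractSimplicialComplex X} (h : K ≤ L) : H₁ R K →ₗ[R] H₁ R L :=
  Submodule.mapQ (oneBoundaries R K) (oneBoundaries R L)
    ((chainMap R h 1).restrict (p := oneCycles R K) (q := oneCycles R L) fun c hc => by
      rw [LinearMap.mem_ker] at hc ⊢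
      rw [boundary_chainMap, hc, map_zero])
    (by
      rintro ⟨c, hc⟩ ⟨b, hb⟩
      exact ⟨chainMap R h 2 b, by rw [boundary_chainMap, hb]; rfl⟩)

end SimplicialChains

/-! ### Cycle graphs -/

/-- A weighted cycle network on the vertices `ℤ/n`, `n ≥ 3`: between distinct vertices there are
edges exactly between `i` and `i + 1`, and each of these edges has exactly one orientation.
Loops `ω i i` play no role and are not restricted. -/
structure IsCycleNetwork {n : ℕ} (ω : Network (ZMod n)) : Prop where
  three_le : 3 ≤ n
  oriented : ∀ i, Xor (ω i (i + 1) < ∞) (ω (i + 1) i < ∞)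
  no_chord : ∀ i j, i ≠ j → ω i j < ∞ → j = i + 1 ∨ i = j + 1

/-- An inconsistently oriented cycle graph: the edges do not all point in the same direction
around the cycle. -/
structure IsInconsistentCycle {n : ℕ} (ω : Network (ZMod n)) : Prop extends
    IsCycleNetwork ω where
  not_all_forward : ¬ ∀ i, ω i (i + 1) < ∞
  not_all_backward : ¬ ∀ i, ω (i + 1) i < ∞

/-- The largest edge weight of a cycle network. One of the two weights between `i` and `i + 1` is
infinite, so their minimum is the weight of the edge that joins them. -/
def maxEdgeWeight {n : ℕ} (ω : Network (ZMod n)) : ℝ≥0∞ :=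
  ⨆ i, min (ω i (i + 1)) (ω (i + 1) i)

end

/-! Lift paths to the line that covers the cycle. Elements of `K` do not reach one another, so no
edge of the cycle is covered by two of them (`eq_of_coversEdge`), while each covers at least one
(`exists_coversEdge`). Since `K` has three elements, no single element, and no two together, can
cover all edges. Hence the vertices reached from `k ∈ K` form an arc that lifts injectively to the
line (`sub_le_of_lineWeight_lt_top`), and two such arcs share at most one vertex
(`not_lt_of_lineWeight_lt_top`).

Every `δ`-ball is an interval inside one of these arcs (`carries_dowkerFiltration`). An ordered edge
of the Dowker complex therefore has a well-defined straight chain in the cycle, and modulo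
boundaries it equals that chain (`fromCycle_toCycle`). A 1-cycle becomes a constant function on the
edges of the cycle, and its value, the winding number, embeds `H₁` in `R`. The image is all of `R`
if each pair `i, i + 1` lies in a face, which holds for `δ ≥ w`. It is `0` if some pair does not, as
for `δ < w`, where a heaviest edge is missing. Winding numbers are preserved by inclusions, which
gives the persistence of the class. -/

open scoped ENNReal NNReal

noncomputable section

/-! ### One-dimensional homology of complexes carried by arcs of a cycle -/

namespace SimplicialChains

/-! ### Ordered edges modulo boundaries. -/

section EdgeClass

variable {X : Type*} (R : Type*) [CommRing R] (D : PreAbstractSimplicialComplex X)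

/-- The ordered edge `(u, v)` of a face. -/
def OrderedSimplex.edge {D : PreAbstractSimplicialComplex X} {u v : X}
    (h : ∃ σ ∈ D, u ∈ σ ∧ v ∈ σ) : OrderedSimplex D 1 :=
  ⟨![u, v], by
    obtain ⟨σ, hσ, hu, hv⟩ := h
    refine ⟨σ, hσ, fun i => ?_⟩
    fin_cases i
    · exact hu
    · exact hv⟩

theorem OrderedSimplex.edge_eta {D : PreAbstractSimplicialComplex X} (v : OrderedSimplex D 1)
    (h : ∃ σ ∈ D, v.1 0 ∈ σ ∧ v.1 1 ∈ σ) : OrderedSimplex.edge h = v := by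
  refine Subtype.ext (funext fun i => ?_)
  fin_cases i <;> rfl

/-- The 1-chains modulo the 1-boundaries. -/
abbrev ChainsModBoundaries := Chains R D 1 ⧸ LinearMap.range (boundary R D 1)

open Classical in
/-- The class of the ordered edge `(u, v)` modulo boundaries; `0` if it is not in the complex. -/
def edgeClass (u v : X) : ChainsModBoundaries R D :=
  if h : ∃ σ ∈ D, u ∈ σ ∧ v ∈ σ then
    Submodule.Quotient.mk (simplexChain R (OrderedSimplex.edge h)) else 0

variable {D}

theorem mk_simplexChain (v : OrderedSimplex D 1) :
    (Submodule.Quotient.mk (simplexChain R v) : ChainsModBoundaries R D) =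
      edgeClass R D (v.1 0) (v.1 1) := by
  have h : ∃ σ ∈ D, v.1 0 ∈ σ ∧ v.1 1 ∈ σ := by
    obtain ⟨σ, hσ, hv⟩ := v.2
    exact ⟨σ, hσ, hv 0, hv 1⟩
  rw [edgeClass, dif_pos h, OrderedSimplex.edge_eta v h]

theorem boundary_simplexChain_one (t : OrderedSimplex D 2) :
    boundary R D 1 (simplexChain R t) =
      simplexChain R (t.face 0) - simplexChain R (t.face 1) + simplexChain R (t.face 2) := by
  rw [boundary, chainLift_simplexChain, Fin.sum_univ_three]
  simp [sub_eq_add_neg]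

theorem boundary_simplexChain_zero (t : OrderedSimplex D 1) :
    boundary R D 0 (simplexChain R t) =
      simplexChain R (t.face 0) - simplexChain R (t.face 1) := by
  rw [boundary, chainLift_simplexChain, Fin.sum_univ_two]
  simp [sub_eq_add_neg]

/-- This is the boundary of the ordered triangle `(u, v, w)`. Repetitions are allowed, so `u = v =
w` shows that degenerate edges have class `0`. -/
theorem edgeClass_add {σ : Finset X} (hσ : σ ∈ D) {u v w : X} (hu : u ∈ σ) (hv : v ∈ σ)
    (hw : w ∈ σ) : edgeClass R D u v + edgeClass R D v w = edgeClass R D u w := by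
  let t : OrderedSimplex D 2 := ⟨![u, v, w], σ, hσ, fun i => by
    fin_cases i
    · exact hu
    · exact hv
    · exact hw⟩
  have h : (Submodule.Quotient.mk (boundary R D 1 (simplexChain R t)) :
      ChainsModBoundaries R D) = 0 :=
    (Submodule.Quotient.mk_eq_zero _).2 ⟨_, rfl⟩
  rw [boundary_simplexChain_one, Submodule.Quotient.mk_add, Submodule.Quotient.mk_sub,
    mk_simplexChain, mk_simplexChain, mk_simplexChain] at h
  change edgeClass R D v w - edgeClass R D u w + edgeClass R D u v = 0 at h
  rw [← sub_eq_zero, ← h]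
  abel

end EdgeClass

end SimplicialChains

open SimplicialChains

/-! ### The chain complex of the cycle graph and its covering line. -/

section CyclePotential

variable {n : ℕ} (R : Type*) [CommRing R]

/-- The 1-chain of the line from `0` to `p`, pushed down to the cycle with `n` edges. -/
def cyclePotential (p : ℤ) : ZMod n → R :=
  ∑ j ∈ Finset.Ico 0 p, Pi.single (j : ZMod n) 1 - ∑ j ∈ Finset.Ico p 0, Pi.single (j : ZMod n) 1

theorem cyclePotential_add_one (p : ℤ) :
    cyclePotential R (p + 1) = cyclePotential R p + Pi.single (p : ZMod n) 1 := by
  unfold cyclePotential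
  rcases le_or_gt 0 p with hp | hp
  · rw [Finset.Ico_eq_empty_of_le hp, Finset.Ico_eq_empty_of_le (by omega : (0 : ℤ) ≤ p + 1),
      ← Finset.insert_Ico_right_eq_Ico_add_one hp, Finset.sum_insert (by simp)]
    simp [add_comm]
  · rw [Finset.Ico_eq_empty_of_le hp.le, Finset.Ico_eq_empty_of_le (by omega : p + 1 ≤ (0 : ℤ)),
      ← Finset.insert_Ico_add_one_left_eq_Ico hp, Finset.sum_insert (by simp)]
    simp

/-- The boundary of 1-chains of the cycle with `n` edges. -/
def cycleBoundary : (ZMod n → R) →ₗ[R] (ZMod n → R) where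
  -- Index `i` of a 1-chain stands for the edge from `i` to `i + 1`, so the vertex `i` is the head
  -- of edge `i - 1` and the tail of edge `i`.
  toFun a i := a (i - 1) - a i
  map_add' a b := by
    funext i
    simp only [Pi.add_apply]
    ring
  map_smul' r a := by
    funext i
    simp only [Pi.smul_apply, smul_eq_mul, RingHom.id_apply]
    ring

theorem cycleBoundary_single (i : ZMod n) :
    cycleBoundary R (Pi.single i 1) = Pi.single (i + 1) 1 - Pi.single i 1 := by
  funext j
  simp only [cycleBoundary, LinearMap.coe_mk, AddHom.coe_mk, Pi.sub_apply, Pi.single_apply,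
    sub_eq_iff_eq_add]

theorem cycleBoundary_cyclePotential_sub {p q : ℤ} :
    cycleBoundary R (cyclePotential R q - cyclePotential R p) =
      Pi.single (q : ZMod n) 1 - Pi.single (p : ZMod n) 1 := by
  suffices H : ∀ q : ℤ, cycleBoundary R (cyclePotential R q) =
      Pi.single (q : ZMod n) 1 - Pi.single ((0 : ℤ) : ZMod n) 1 by
    rw [map_sub, H, H]
    abel
  have step (q : ℤ) : cycleBoundary R (cyclePotential R (q + 1)) =
      cycleBoundary R (cyclePotential R q) +
        (Pi.single ((q + 1 : ℤ) : ZMod n) 1 - Pi.single (q : ZMod n) 1) := by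
    rw [cyclePotential_add_one, map_add, cycleBoundary_single]
    push_cast
    rfl
  intro q
  induction q with
  | zero => simp [cyclePotential]
  | succ k ih =>
    rw [step, ih]
    abel
  | pred k ih =>
    have h := step (-(k : ℤ) - 1)
    rw [sub_add_cancel, ih] at h
    rw [← sub_eq_iff_eq_add] at h
    rw [← h]
    abel

theorem eq_of_cycleBoundary_eq_zero [NeZero n] {a : ZMod n → R} (h : cycleBoundary R a = 0)
    (i j : ZMod n) : a i = a j := by
  have step (i : ZMod n) : a (i - 1) = a i := sub_eq_zero.1 (congrFun h i)
  suffices H : ∀ m : ℕ, a (m : ZMod n) = a 0 by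
    rw [← ZMod.natCast_zmod_val i, ← ZMod.natCast_zmod_val j, H, H]
  intro m
  induction m with
  | zero => simp
  | succ m ih =>
    rw [← ih, ← step, Nat.cast_add_one, add_sub_cancel_right]

theorem cyclePotential_sub_mem {N : Submodule R (ZMod n → R)} {p q : ℤ} (hpq : p ≤ q)
    (h : ∀ i, p ≤ i → i < q → Pi.single (i : ZMod n) 1 ∈ N) :
    cyclePotential R q - cyclePotential R p ∈ N := by
  induction q, hpq using Int.leInduction with
  | base => simp
  | succ q hq ih =>
    rw [cyclePotential_add_one, add_sub_right_comm]
    exact N.add_mem (ih fun i h₁ h₂ => h i h₁ (by omega)) (h q hq (by omega))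

end CyclePotential

/-- A family of arcs in the cycle `ℤ/n`, with coordinates that lift each arc to the line, such
that different arcs share at most one vertex. -/
structure ArcSystem (n : ℕ) (ι : Type*) where
  /-- The arcs. -/
  arc : ι → Set (ZMod n)
  /-- The coordinate on each arc. -/
  lift : ι → ZMod n → ℤ
  lift_cast : ∀ k, ∀ x ∈ arc k, (lift k x : ZMod n) = x
  lift_add_one : ∀ k, ∀ x ∈ arc k, x + 1 ∈ arc k → lift k (x + 1) = lift k x + 1
  -- This makes `step` independent of the chosen arc; a pair of equal vertices gives `0` in every
  -- arc.
  eq_of_mem : ∀ k l x y, x ≠ y → x ∈ arc k → y ∈ arc k → x ∈ arc l → y ∈ arc l → k = l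

/-! ### Comparison of a carried complex with the cycle graph. -/

namespace ArcSystem

variable {n : ℕ} {ι : Type*} (A : ArcSystem n ι)

/-- Every face of `D` lies in a face that is a subarc of one of the arcs. -/
def Carries (D : PreAbstractSimplicialComplex (ZMod n)) : Prop :=
  ∀ σ ∈ D, ∃ k, ∃ τ ∈ D, σ ⊆ τ ∧ (∀ x ∈ τ, x ∈ A.arc k) ∧
    ∀ u ∈ τ, ∀ v ∈ τ, ∀ p : ℤ, A.lift k u ≤ p → p ≤ A.lift k v → (p : ZMod n) ∈ τ

variable (R : Type*) [CommRing R]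

open Classical in
/-- The 1-chain of the cycle that runs from `u` to `v` in an arc containing both. -/
def step (u v : ZMod n) : ZMod n → R :=
  if h : ∃ k, u ∈ A.arc k ∧ v ∈ A.arc k then
    cyclePotential R (A.lift h.choose v) - cyclePotential R (A.lift h.choose u) else 0

theorem step_eq {k : ι} {u v : ZMod n} (hu : u ∈ A.arc k) (hv : v ∈ A.arc k) :
    A.step R u v = cyclePotential R (A.lift k v) - cyclePotential R (A.lift k u) := by
  have h : ∃ k, u ∈ A.arc k ∧ v ∈ A.arc k := ⟨k, hu, hv⟩
  rw [step, dif_pos h]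
  by_cases huv : u = v
  · subst huv
    simp
  · rw [A.eq_of_mem k h.choose u v huv hu hv h.choose_spec.1 h.choose_spec.2]

/-- The linear extension of `ArcSystem.step` to the 1-chains of a complex. -/
def toCycle (D : PreAbstractSimplicialComplex (ZMod n)) : Chains R D 1 →ₗ[R] (ZMod n → R) :=
  chainLift R fun v => A.step R (v.1 0) (v.1 1)

theorem toCycle_simplexChain {D : PreAbstractSimplicialComplex (ZMod n)}
    (v : OrderedSimplex D 1) : A.toCycle R D (simplexChain R v) = A.step R (v.1 0) (v.1 1) :=
  chainLift_simplexChain R _ v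

theorem toCycle_chainMap {D E : PreAbstractSimplicialComplex (ZMod n)} (h : D ≤ E)
    (c : Chains R D 1) : A.toCycle R E (chainMap R h 1 c) = A.toCycle R D c := by
  suffices H : A.toCycle R E ∘ₗ chainMap R h 1 = A.toCycle R D from LinearMap.congr_fun H c
  refine chains_hom_ext R fun v => ?_
  rw [LinearMap.comp_apply, chainMap, chainLift_simplexChain, toCycle_simplexChain,
    toCycle_simplexChain]
  rfl

variable {A} {D : PreAbstractSimplicialComplex (ZMod n)}

/-- The three vertices of an ordered triangle lie in a common arc, where `step` is a difference of
potentials, so the sum telescopes. -/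
theorem toCycle_boundary (hD : A.Carries D) (c : Chains R D 2) :
    A.toCycle R D (boundary R D 1 c) = 0 := by
  suffices H : A.toCycle R D ∘ₗ boundary R D 1 = 0 from LinearMap.congr_fun H c
  refine chains_hom_ext R fun t => ?_
  obtain ⟨σ, hσ, ht⟩ := t.2
  obtain ⟨k, τ, -, hστ, hk, -⟩ := hD σ hσ
  have ht' (i) : t.1 i ∈ A.arc k := hk _ (hστ (ht i))
  rw [LinearMap.comp_apply, boundary_simplexChain_one, map_add, map_sub, toCycle_simplexChain,
    toCycle_simplexChain, toCycle_simplexChain]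
  change A.step R (t.1 1) (t.1 2) - A.step R (t.1 0) (t.1 2) + A.step R (t.1 0) (t.1 1) = 0
  rw [A.step_eq R (ht' 1) (ht' 2), A.step_eq R (ht' 0) (ht' 2), A.step_eq R (ht' 0) (ht' 1)]
  abel

theorem cycleBoundary_toCycle (hD : A.Carries D) (c : Chains R D 1) :
    cycleBoundary R (A.toCycle R D c) =
      chainLift R (fun v => Pi.single (v.1 0) 1) (boundary R D 0 c) := by
  suffices H : cycleBoundary R ∘ₗ A.toCycle R D =
      chainLift R (fun v => Pi.single (v.1 0) 1) ∘ₗ boundary R D 0 from LinearMap.congr_fun H c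
  refine chains_hom_ext R fun v => ?_
  obtain ⟨σ, hσ, hv⟩ := v.2
  obtain ⟨k, τ, -, hστ, hk, -⟩ := hD σ hσ
  have hv' (i) : v.1 i ∈ A.arc k := hk _ (hστ (hv i))
  rw [LinearMap.comp_apply, LinearMap.comp_apply, toCycle_simplexChain,
    A.step_eq R (hv' 0) (hv' 1), cycleBoundary_cyclePotential_sub, boundary_simplexChain_zero,
    map_sub, chainLift_simplexChain, chainLift_simplexChain, A.lift_cast k _ (hv' 0),
    A.lift_cast k _ (hv' 1)]
  rfl

theorem toCycle_apply_eq [NeZero n] (hD : A.Carries D) {c : Chains R D 1}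
    (hc : c ∈ oneCycles R D) (i j : ZMod n) : A.toCycle R D c i = A.toCycle R D c j := by
  refine eq_of_cycleBoundary_eq_zero R ?_ i j
  rw [cycleBoundary_toCycle R hD, LinearMap.mem_ker.1 hc, map_zero]

/-- A straight chain that uses edge `i` runs through `i` and `i + 1`; by convexity both would lie in
the face `τ`. -/
theorem toCycle_apply_eq_zero (hD : A.Carries D) {i : ZMod n}
    (hi : ¬ ∃ σ ∈ D, i ∈ σ ∧ i + 1 ∈ σ) (c : Chains R D 1) : A.toCycle R D c i = 0 := by
  suffices H : LinearMap.proj i ∘ₗ A.toCycle R D = 0 from LinearMap.congr_fun H c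
  refine chains_hom_ext R fun v => ?_
  obtain ⟨σ, hσ, hv⟩ := v.2
  obtain ⟨k, τ, hτ, hστ, hk, hconv⟩ := hD σ hσ
  have key (u : ZMod n) (hu : u ∈ τ) (w : ZMod n) (hw : w ∈ τ) (h : A.lift k u ≤ A.lift k w) :
      (cyclePotential R (A.lift k w) - cyclePotential R (A.lift k u) : ZMod n → R) i = 0 := by
    refine LinearMap.mem_ker.1 (cyclePotential_sub_mem R
      (N := LinearMap.ker (LinearMap.proj (R := R) (φ := fun _ => R) i)) h fun p h₁ h₂ => ?_)
    refine LinearMap.mem_ker.2 (Pi.single_eq_of_ne ?_ _)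
    rintro rfl
    refine hi ⟨τ, hτ, hconv u hu w hw p h₁ h₂.le, ?_⟩
    have := hconv u hu w hw (p + 1) (by omega) (by omega)
    rwa [Int.cast_add, Int.cast_one] at this
  have h₀ := hστ (hv 0)
  have h₁ := hστ (hv 1)
  rw [LinearMap.comp_apply, toCycle_simplexChain, A.step_eq R (hk _ h₀) (hk _ h₁)]
  rcases le_total (A.lift k (v.1 0)) (A.lift k (v.1 1)) with h | h
  · exact key _ h₀ _ h₁ h
  · rw [← neg_sub, map_neg]
    exact neg_eq_zero.2 (key _ h₁ _ h₀ h)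

/-- The class modulo boundaries of the 1-chain of the cycle with coefficients `a`. -/
def fromCycle [NeZero n] (D : PreAbstractSimplicialComplex (ZMod n)) :
    (ZMod n → R) →ₗ[R] ChainsModBoundaries R D :=
  Fintype.linearCombination R fun i => edgeClass R D i (i + 1)

theorem fromCycle_single [NeZero n] (i : ZMod n) :
    fromCycle R D (Pi.single i 1) = edgeClass R D i (i + 1) := by
  rw [fromCycle, Fintype.linearCombination_apply_single, one_smul]

/-- Convexity of `τ` lets an edge be subdivided into unit edges without leaving the face, and
`edgeClass_add` then adds these up. -/
theorem fromCycle_toCycle [NeZero n] (hD : A.Carries D) (c : Chains R D 1) :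
    fromCycle R D (A.toCycle R D c) = Submodule.Quotient.mk c := by
  suffices H : fromCycle R D ∘ₗ A.toCycle R D = Submodule.mkQ _ from LinearMap.congr_fun H c
  refine chains_hom_ext R fun v => ?_
  obtain ⟨σ, hσ, hv⟩ := v.2
  obtain ⟨k, τ, hτ, hστ, hk, hconv⟩ := hD σ hσ
  have key (u : ZMod n) (hu : u ∈ τ) (w : ZMod n) (hw : w ∈ τ) (h : A.lift k u ≤ A.lift k w) :
      fromCycle R D (cyclePotential R (A.lift k w) - cyclePotential R (A.lift k u)) =
        edgeClass R D u w := by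
    have aux (q : ℤ) (hq : A.lift k u ≤ q) : q ≤ A.lift k w →
        fromCycle R D (cyclePotential R q - cyclePotential R (A.lift k u)) =
          edgeClass R D u (q : ZMod n) := by
      induction q, hq using Int.leInduction with
      | base =>
        intro _
        rw [sub_self, map_zero, A.lift_cast k u (hk u hu), eq_comm]
        simpa using edgeClass_add R hτ hu hu hu
      | succ q hq ih =>
        intro hq'
        have h₁ := hconv u hu w hw q hq (by omega)
        have h₂ := hconv u hu w hw (q + 1) (by omega) hq'
        rw [cyclePotential_add_one, add_sub_right_comm, map_add, ih (by omega), fromCycle_single]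
        rw [Int.cast_add, Int.cast_one] at h₂ ⊢
        exact edgeClass_add R hτ hu h₁ h₂
    rw [aux _ h le_rfl, A.lift_cast k w (hk w hw)]
  have h₀ := hστ (hv 0)
  have h₁ := hστ (hv 1)
  rw [LinearMap.comp_apply, toCycle_simplexChain, A.step_eq R (hk _ h₀) (hk _ h₁),
    Submodule.mkQ_apply, mk_simplexChain]
  rcases le_total (A.lift k (v.1 0)) (A.lift k (v.1 1)) with h | h
  · exact key _ h₀ _ h₁ h
  · rw [← neg_sub, map_neg, key _ h₁ _ h₀ h, neg_eq_iff_add_eq_zero, edgeClass_add R hτ h₁ h₀ h₁]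
    simpa using edgeClass_add R hτ h₁ h₁ h₁

/-- The winding number of a 1-cycle, as a map on first homology. -/
def winding (hD : A.Carries D) : H₁ R D →ₗ[R] R :=
  Submodule.liftQ _ (LinearMap.proj 0 ∘ₗ A.toCycle R D ∘ₗ (oneCycles R D).subtype) (by
    rintro ⟨c, hc⟩ ⟨b, hb⟩
    rw [LinearMap.mem_ker, LinearMap.comp_apply, LinearMap.comp_apply]
    change LinearMap.proj 0 (A.toCycle R D c) = 0
    have hb' : boundary R D 1 b = c := hb
    rw [← hb', toCycle_boundary R hD, map_zero])

theorem winding_mk (hD : A.Carries D) (c : oneCycles R D) :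
    winding R hD (Submodule.Quotient.mk c) = A.toCycle R D c.1 0 := rfl

/-- The image of a 1-cycle in the cycle graph is constant, so it vanishes when one coefficient does;
`fromCycle_toCycle` then exhibits the 1-cycle as a boundary. -/
theorem winding_injective [NeZero n] (hD : A.Carries D) :
    Function.Injective (winding R hD) := by
  rw [injective_iff_map_eq_zero]
  intro x hx
  obtain ⟨⟨c, hc⟩, rfl⟩ := Submodule.Quotient.mk_surjective _ x
  rw [winding_mk] at hx
  have h : A.toCycle R D c = 0 := funext fun i => (toCycle_apply_eq R hD hc i 0).trans hx
  have h' := fromCycle_toCycle R hD c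
  rw [h, map_zero] at h'
  have hb : c ∈ LinearMap.range (boundary R D 1) := (Submodule.Quotient.mk_eq_zero _).1 h'.symm
  exact (Submodule.Quotient.mk_eq_zero _).2 hb

theorem winding_surjective [NeZero n] (hD : A.Carries D)
    (hE : ∀ i : ZMod n, ∃ σ ∈ D, i ∈ σ ∧ i + 1 ∈ σ) : Function.Surjective (winding R hD) := by
  intro r
  -- The fundamental cycle, which goes once around and has winding number `1`.
  let z : Chains R D 1 := ∑ i : ZMod n, simplexChain R (OrderedSimplex.edge (hE i))
  have hz : z ∈ oneCycles R D := by
    let V (i : ZMod n) : OrderedSimplex D 0 := ⟨fun _ => i, by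
      obtain ⟨σ, hσ, hi, -⟩ := hE i
      exact ⟨σ, hσ, fun _ => hi⟩⟩
    have h (i : ZMod n) : boundary R D 0 (simplexChain R (OrderedSimplex.edge (hE i))) =
        simplexChain R (V (i + 1)) - simplexChain R (V i) := by
      rw [boundary_simplexChain_zero]
      congr 2 <;> exact Subtype.ext (funext fun j => by fin_cases j; rfl)
    rw [LinearMap.mem_ker, map_sum, Finset.sum_congr rfl fun i _ => h i, Finset.sum_sub_distrib,
      sub_eq_zero]
    exact Equiv.sum_comp (Equiv.addRight (1 : ZMod n)) fun i => simplexChain R (V i)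
  have hz' : A.toCycle R D z 0 = 1 := by
    have h (i : ZMod n) : A.toCycle R D (simplexChain R (OrderedSimplex.edge (hE i))) =
        Pi.single i 1 := by
      obtain ⟨σ, hσ, hi, hi'⟩ := hE i
      obtain ⟨k, τ, -, hστ, hk, -⟩ := hD σ hσ
      rw [toCycle_simplexChain]
      change A.step R i (i + 1) = _
      have h₁ := hk _ (hστ hi)
      rw [A.step_eq R h₁ (hk _ (hστ hi')), A.lift_add_one k i h₁ (hk _ (hστ hi')),
        cyclePotential_add_one, add_sub_cancel_left, A.lift_cast k i h₁]
    rw [map_sum, Finset.sum_congr rfl fun i _ => h i, Finset.sum_apply,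
      Finset.sum_pi_single]
    simp
  refine ⟨Submodule.Quotient.mk (r • ⟨z, hz⟩), ?_⟩
  rw [Submodule.Quotient.mk_smul, map_smul, winding_mk, hz', smul_eq_mul, mul_one]

theorem winding_H₁map {E : PreAbstractSimplicialComplex (ZMod n)} (hD : A.Carries D)
    (hE : A.Carries E) (h : D ≤ E) (x : H₁ R D) :
    winding R hE (H₁map R h x) = winding R hD x := by
  obtain ⟨c, rfl⟩ := Submodule.Quotient.mk_surjective _ x
  exact congrFun (A.toCycle_chainMap R h c.1) 0

theorem subsingleton_H₁ [NeZero n] (hD : A.Carries D) {i : ZMod n}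
    (hi : ¬ ∃ σ ∈ D, i ∈ σ ∧ i + 1 ∈ σ) : Subsingleton (H₁ R D) := by
  have h (x : H₁ R D) : winding R hD x = 0 := by
    obtain ⟨c, rfl⟩ := Submodule.Quotient.mk_surjective _ x
    rw [winding_mk, toCycle_apply_eq R hD c.2 0 i, toCycle_apply_eq_zero R hD hi]
  exact ⟨fun x y => winding_injective R hD ((h x).trans (h y).symm)⟩

end ArcSystem

/-! ### Path completions of cycle networks -/

namespace Network

theorem pathCompletion_le_sum_range {X : Type*} (ω : Network X) (f : ℕ → X) (m : ℕ) :
    ω.pathCompletion (f 0) (f m) ≤ ∑ j ∈ Finset.range m, ω (f j) (f (j + 1)) := by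
  refine (iInf_le_of_le m (iInf_le_of_le (fun i => f i) (iInf_le_of_le rfl
    (iInf_le_of_le rfl ?_))))
  rw [pathWeight, ← Fin.sum_univ_eq_sum_range fun j => ω (f j) (f (j + 1))]
  rfl

variable {n : ℕ} (ω : Network (ZMod n))

/-- The weight of the straight path from `p` to `q` in the line that covers the cycle. -/
def lineWeight (p q : ℤ) : ℝ≥0∞ :=
  ∑ i ∈ Finset.Ico p q, ω (i : ZMod n) ((i + 1 : ℤ) : ZMod n) +
    ∑ i ∈ Finset.Ico q p, ω ((i + 1 : ℤ) : ZMod n) (i : ZMod n)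

variable {ω}

theorem lineWeight_of_le {p q : ℤ} (h : p ≤ q) : ω.lineWeight p q =
    ∑ i ∈ Finset.Ico p q, ω (i : ZMod n) ((i + 1 : ℤ) : ZMod n) := by
  rw [lineWeight, Finset.Ico_eq_empty_of_le h, Finset.sum_empty, add_zero]

theorem lineWeight_of_ge {p q : ℤ} (h : q ≤ p) : ω.lineWeight p q =
    ∑ i ∈ Finset.Ico q p, ω ((i + 1 : ℤ) : ZMod n) (i : ZMod n) := by
  rw [lineWeight, Finset.Ico_eq_empty_of_le h, Finset.sum_empty, zero_add]

@[simp]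
theorem lineWeight_self (p : ℤ) : ω.lineWeight p p = 0 := by
  simp [lineWeight]

theorem lineWeight_add_one (p : ℤ) :
    ω.lineWeight p (p + 1) = ω (p : ZMod n) ((p + 1 : ℤ) : ZMod n) := by
  rw [lineWeight_of_le (by omega), Finset.sum_eq_single_of_mem p (by simp)]
  intro i hi hne
  rw [Finset.mem_Ico] at hi
  omega

theorem lineWeight_add_one_left (p : ℤ) :
    ω.lineWeight (p + 1) p = ω ((p + 1 : ℤ) : ZMod n) (p : ZMod n) := by
  rw [lineWeight_of_ge (by omega), Finset.sum_eq_single_of_mem p (by simp)]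
  intro i hi hne
  rw [Finset.mem_Ico] at hi
  omega

theorem lineWeight_triangle (p q r : ℤ) :
    ω.lineWeight p r ≤ ω.lineWeight p q + ω.lineWeight q r := by
  have key (f : ℤ → ℝ≥0∞) (a b c : ℤ) : ∑ i ∈ Finset.Ico a c, f i ≤
      ∑ i ∈ Finset.Ico a b, f i + ∑ i ∈ Finset.Ico b c, f i := by
    rw [← Finset.sum_union_inter]
    refine (Finset.sum_le_sum_of_subset fun i hi => ?_).trans le_self_add
    simp only [Finset.mem_union, Finset.mem_Ico] at hi ⊢
    omega
  refine (add_le_add (key _ p q r) (key _ r q p)).trans_eq ?_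
  unfold lineWeight
  abel

theorem forward_le_lineWeight {p q i : ℤ} (h₁ : p ≤ i) (h₂ : i < q) :
    ω (i : ZMod n) ((i + 1 : ℤ) : ZMod n) ≤ ω.lineWeight p q := by
  rw [lineWeight_of_le (by omega)]
  exact Finset.single_le_sum (f := fun i : ℤ => ω (i : ZMod n) ((i + 1 : ℤ) : ZMod n))
    (fun _ _ => zero_le) (Finset.mem_Ico.2 ⟨h₁, h₂⟩)

theorem backward_le_lineWeight {p q i : ℤ} (h₁ : q ≤ i) (h₂ : i < p) :
    ω ((i + 1 : ℤ) : ZMod n) (i : ZMod n) ≤ ω.lineWeight p q := by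
  rw [lineWeight_of_ge (by omega)]
  exact Finset.single_le_sum (f := fun i : ℤ => ω ((i + 1 : ℤ) : ZMod n) (i : ZMod n))
    (fun _ _ => zero_le) (Finset.mem_Ico.2 ⟨h₁, h₂⟩)

/-- The straight path from `s` to `p` is an initial piece of the one to `a` or to `b`. This is why
balls are intervals. -/
theorem lineWeight_le_of_between {s p a b : ℤ} {c : ℝ≥0∞} (ha : ω.lineWeight s a ≤ c)
    (hb : ω.lineWeight s b ≤ c) (h₁ : a ≤ p) (h₂ : p ≤ b) : ω.lineWeight s p ≤ c := by
  rcases le_total s p with h | h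
  · refine le_trans ?_ hb
    rw [lineWeight_of_le h, lineWeight_of_le (h.trans h₂)]
    exact Finset.sum_le_sum_of_subset (Finset.Ico_subset_Ico_right h₂)
  · refine le_trans ?_ ha
    rw [lineWeight_of_ge h, lineWeight_of_ge (h₁.trans h)]
    exact Finset.sum_le_sum_of_subset (Finset.Ico_subset_Ico_left h₁)

theorem lineWeight_lt_top_of_between {s p a b : ℤ} (ha : ω.lineWeight s a < ∞)
    (hb : ω.lineWeight s b < ∞) (h₁ : a ≤ p) (h₂ : p ≤ b) : ω.lineWeight s p < ∞ :=
  (lineWeight_le_of_between (le_max_left _ _) (le_max_right _ _) h₁ h₂).trans_lt (max_lt ha hb)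

theorem lineWeight_shift (p q m : ℤ) :
    ω.lineWeight (p + n * m) (q + n * m) = ω.lineWeight p q := by
  rw [lineWeight, lineWeight,
    ← Finset.sum_Ico_add' (fun i : ℤ => ω (i : ZMod n) ((i + 1 : ℤ) : ZMod n)),
    ← Finset.sum_Ico_add' (fun i : ℤ => ω ((i + 1 : ℤ) : ZMod n) (i : ZMod n))]
  simp

theorem pathCompletion_le_lineWeight (p q : ℤ) :
    ω.pathCompletion (p : ZMod n) (q : ZMod n) ≤ ω.lineWeight p q := by
  rcases le_total p q with h | h
  · obtain ⟨m, rfl⟩ := Int.le.dest h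
    refine (le_of_eq_of_le (by simp) (ω.pathCompletion_le_sum_range
      (fun j => ((p + j : ℤ) : ZMod n)) m)).trans_eq ?_
    clear h
    induction m with
    | zero => simp
    | succ m ih =>
      rw [Finset.sum_range_succ, ih, lineWeight_of_le (by omega), lineWeight_of_le (by omega),
        Nat.cast_succ, ← add_assoc, ← Finset.insert_Ico_right_eq_Ico_add_one (by omega),
        Finset.sum_insert (by simp), add_comm]
  · obtain ⟨m, rfl⟩ := Int.le.dest h
    have hq : q = q + m - m := by omega
    refine (le_of_eq_of_le (by simp) (ω.pathCompletion_le_sum_range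
      (fun j => ((q + m - j : ℤ) : ZMod n)) m)).trans_eq ?_
    clear h hq
    induction m generalizing q with
    | zero => simp
    | succ m ih =>
      have h := ih (q + 1)
      rw [lineWeight_of_ge (by omega)] at h ⊢
      rw [← Finset.insert_Ico_add_one_left_eq_Ico (by omega), Finset.sum_insert (by simp),
        Finset.sum_range_succ, add_comm]
      congr 1
      · congr 2 <;> push_cast <;> ring
      · rw [show q + ((m + 1 : ℕ) : ℤ) = q + 1 + m by push_cast; ring, h]

/-- Without chords, each step of finite weight lifts to a step by `1` or `-1` on the line, or is a
loop and can be dropped. The straight path to the end of the lift costs no more, by the triangle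
inequality. -/
theorem exists_lineWeight_le_pathWeight (hω : IsCycleNetwork ω) {m : ℕ}
    (x : Fin (m + 1) → ZMod n) (hx : ω.pathWeight x < ∞) (p : ℤ) (hp : (p : ZMod n) = x 0) :
    ∃ q : ℤ, (q : ZMod n) = x (Fin.last m) ∧ ω.lineWeight p q ≤ ω.pathWeight x := by
  induction m with
  | zero => exact ⟨p, hp, by simp⟩
  | succ m ih =>
    have hsum : ω.pathWeight x = ω.pathWeight (fun i => x i.castSucc) +
        ω (x (Fin.last m).castSucc) (x (Fin.last (m + 1))) := Fin.sum_univ_castSucc _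
    rw [hsum] at hx ⊢
    obtain ⟨h₁, h₂⟩ := ENNReal.add_lt_top.1 hx
    obtain ⟨q, hq, hpq⟩ := ih (fun i => x i.castSucc) h₁ hp
    by_cases hloop : x (Fin.last m).castSucc = x (Fin.last (m + 1))
    · exact ⟨q, hq.trans hloop, hpq.trans le_self_add⟩
    rcases hω.no_chord _ _ hloop h₂ with h | h
    · have hq' : ((q + 1 : ℤ) : ZMod n) = x (Fin.last (m + 1)) := by
        rw [Int.cast_add, Int.cast_one, hq, h]
      refine ⟨q + 1, hq', (lineWeight_triangle p q (q + 1)).trans (add_le_add hpq ?_)⟩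
      rw [lineWeight_add_one, hq', hq]
    · have hq' : ((q - 1 : ℤ) : ZMod n) = x (Fin.last (m + 1)) := by
        rw [Int.cast_sub, Int.cast_one, hq, h, add_sub_cancel_right]
      refine ⟨q - 1, hq', (lineWeight_triangle p q (q - 1)).trans (add_le_add hpq ?_)⟩
      have := lineWeight_add_one_left (ω := ω) (q - 1)
      rw [sub_add_cancel, hq', hq] at this
      exact this.le

/-- Full turns can be cut off. Only finitely many end points remain, so the infimum in
`pathCompletion` is attained by a straight path when it is finite. -/
theorem exists_near_lineWeight_le [NeZero n] (p q : ℤ) :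
    ∃ q' ∈ Finset.Ioo (p - n) (p + n), (q' : ZMod n) = q ∧
      ω.lineWeight p q' ≤ ω.lineWeight p q := by
  have hn : (0 : ℤ) < n := by exact_mod_cast NeZero.pos n
  rcases le_total p q with h | h
  · have h₁ := Int.emod_add_mul_ediv (q - p) n
    have h₂ := Int.emod_nonneg (q - p) hn.ne'
    have h₃ := Int.emod_lt_of_pos (q - p) hn
    have h₄ : 0 ≤ (n : ℤ) * ((q - p) / n) := mul_nonneg hn.le (Int.ediv_nonneg (by omega) hn.le)
    refine ⟨p + (q - p) % n, Finset.mem_Ioo.2 ⟨by omega, by omega⟩, ?_, ?_⟩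
    · simp
    · exact lineWeight_le_of_between (a := p) (by simp) le_rfl (by omega) (by omega)
  · have h₁ := Int.emod_add_mul_ediv (p - q) n
    have h₂ := Int.emod_nonneg (p - q) hn.ne'
    have h₃ := Int.emod_lt_of_pos (p - q) hn
    have h₄ : 0 ≤ (n : ℤ) * ((p - q) / n) := mul_nonneg hn.le (Int.ediv_nonneg (by omega) hn.le)
    refine ⟨p - (p - q) % n, Finset.mem_Ioo.2 ⟨by omega, by omega⟩, ?_, ?_⟩
    · simp
    · exact lineWeight_le_of_between (b := p) le_rfl (by simp) (by omega) (by omega)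

theorem exists_lineWeight_le_pathCompletion [NeZero n] (hω : IsCycleNetwork ω) {p : ℤ}
    {x : ZMod n} (h : ω.pathCompletion p x < ∞) :
    ∃ q : ℤ, (q : ZMod n) = x ∧ ω.lineWeight p q ≤ ω.pathCompletion p x := by
  let F := (Finset.Ioo (p - n) (p + n)).filter fun q : ℤ => (q : ZMod n) = x
  have key {m : ℕ} (y : Fin (m + 1) → ZMod n) (h₀ : y 0 = p) (h₁ : y (Fin.last m) = x)
      (hy : ω.pathWeight y < ∞) : ∃ q ∈ F, ω.lineWeight p q ≤ ω.pathWeight y := by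
    obtain ⟨q, hq, hle⟩ := exists_lineWeight_le_pathWeight hω y hy p h₀.symm
    obtain ⟨q', hq', hqq, hle'⟩ := exists_near_lineWeight_le (ω := ω) p q
    exact ⟨q', Finset.mem_filter.2 ⟨hq', hqq.trans (hq.trans h₁)⟩, hle'.trans hle⟩
  have hF : F.Nonempty := by
    simp only [pathCompletion, iInf_lt_iff] at h
    obtain ⟨m, y, h₀, h₁, hy⟩ := h
    obtain ⟨q, hq, -⟩ := key y h₀ h₁ hy
    exact ⟨q, hq⟩
  obtain ⟨q, hq, hmin⟩ := F.exists_min_image (ω.lineWeight p) hF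
  refine ⟨q, (Finset.mem_filter.1 hq).2, ?_⟩
  refine le_iInf fun m => le_iInf fun y => le_iInf fun h₀ => le_iInf fun h₁ => ?_
  rcases lt_or_ge (ω.pathWeight y) ∞ with hy | hy
  · obtain ⟨q', hq', hle⟩ := key y h₀ h₁ hy
    exact (hmin q' hq').trans hle
  · exact le_top.trans hy

/-! ### Minimal dominating sets and the edges covered by their elements. -/

theorem pathCompletion_lt_top_trans [NeZero n] (hω : IsCycleNetwork ω) {x y z : ZMod n}
    (h₁ : ω.pathCompletion x y < ∞) (h₂ : ω.pathCompletion y z < ∞) :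
    ω.pathCompletion x z < ∞ := by
  obtain ⟨p, rfl⟩ := ZMod.intCast_surjective x
  obtain ⟨q, rfl, hq⟩ := exists_lineWeight_le_pathCompletion hω h₁
  obtain ⟨r, rfl, hr⟩ := exists_lineWeight_le_pathCompletion hω h₂
  exact ((pathCompletion_le_lineWeight p r).trans (lineWeight_triangle p q r)).trans_lt
    (ENNReal.add_lt_top.2 ⟨hq.trans_lt h₁, hr.trans_lt h₂⟩)

theorem IsMinimalSourceDominating.eq_of_lt_top [NeZero n] (hω : IsCycleNetwork ω)
    {K : Set (ZMod n)} (hK : ω.pathCompletion.IsMinimalSourceDominating K) {k l : ZMod n}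
    (hk : k ∈ K) (hl : l ∈ K) (h : ω.pathCompletion k l < ∞) : k = l := by
  by_contra hne
  have hdom : ω.pathCompletion.IsSourceDominating (K \ {l}) := by
    intro x
    obtain ⟨j, hj, hjx⟩ := hK.1 x
    by_cases hjl : j = l
    · subst hjl
      exact ⟨k, ⟨hk, hne⟩, pathCompletion_lt_top_trans hω h hjx⟩
    · exact ⟨j, ⟨hj, hjl⟩, hjx⟩
  exact (hK.2 hdom Set.sdiff_subset hl).2 rfl

variable (ω) in
/-- The vertex `k` reaches both ends of the edge between `e` and `e + 1` along one path. -/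
def CoversEdge (k e : ZMod n) : Prop :=
  ∃ s p : ℤ, (s : ZMod n) = k ∧ (p : ZMod n) = e ∧ ω.lineWeight s p < ∞ ∧
    ω.lineWeight s (p + 1) < ∞

theorem coversEdge_of_between {s a b p : ℤ} (ha : ω.lineWeight s a < ∞)
    (hb : ω.lineWeight s b < ∞) (h₁ : a ≤ p) (h₂ : p < b) : ω.CoversEdge s p :=
  ⟨s, p, rfl, rfl, lineWeight_lt_top_of_between ha hb h₁ h₂.le,
    lineWeight_lt_top_of_between ha hb (by omega) h₂⟩

theorem intCast_eq_iff_exists {p q : ℤ} : (p : ZMod n) = q ↔ ∃ m : ℤ, q = p + n * m := by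
  rw [ZMod.intCast_eq_intCast_iff_dvd_sub]
  exact exists_congr fun m => by constructor <;> intro h <;> linarith

theorem exists_intCast_eq_of_le [NeZero n] (a : ℤ) (e : ZMod n) :
    ∃ p : ℤ, a ≤ p ∧ p < a + n ∧ (p : ZMod n) = e := by
  have := ZMod.val_lt (e - (a : ZMod n))
  exact ⟨a + (e - (a : ZMod n)).val, by omega, by omega, by simp⟩

/-- After a shift by a multiple of `n`, both elements reach the same lifted edge. From opposite
sides they would traverse it in both directions, against `oriented`. From the same side, the farther
one passes through the nearer one, so they are equal. -/
theorem eq_of_coversEdge [NeZero n] (hω : IsCycleNetwork ω) {K : Set (ZMod n)}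
    (hK : ω.pathCompletion.IsMinimalSourceDominating K) {k l e : ZMod n} (hk : k ∈ K)
    (hl : l ∈ K) (hke : ω.CoversEdge k e) (hle : ω.CoversEdge l e) : k = l := by
  obtain ⟨s, p, rfl, rfl, h₁, h₂⟩ := hke
  obtain ⟨t, q, rfl, hq, h₃, h₄⟩ := hle
  obtain ⟨m, rfl⟩ := intCast_eq_iff_exists.1 hq
  obtain ⟨r, rfl⟩ : ∃ r, s = r + n * m := ⟨s - n * m, by ring⟩
  rw [add_right_comm, lineWeight_shift] at h₂
  rw [lineWeight_shift] at h₁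
  have hr : ((r + n * m : ℤ) : ZMod n) = r := by simp
  rw [hr] at hk ⊢
  have hxor := hω.oriented (q : ZMod n)
  rw [← Int.cast_one, ← Int.cast_add, Xor] at hxor
  have reach {a b : ℤ} (ha : (a : ZMod n) ∈ K) (hb : (b : ZMod n) ∈ K)
      (h : ω.lineWeight a b < ∞) : (a : ZMod n) = b :=
    hK.eq_of_lt_top hω ha hb ((pathCompletion_le_lineWeight a b).trans_lt h)
  rcases le_or_gt r q with hrq | hrq <;> rcases le_or_gt t q with htq | htq
  · rcases le_total r t with h | h
    · exact reach hk hl (lineWeight_lt_top_of_between (a := r) (by simp) h₁ h htq)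
    · exact (reach hl hk (lineWeight_lt_top_of_between (a := t) (by simp) h₃ h hrq)).symm
  · have := (forward_le_lineWeight hrq (by omega)).trans_lt h₂
    have := (backward_le_lineWeight le_rfl htq).trans_lt h₃
    tauto
  · have := (forward_le_lineWeight htq (by omega)).trans_lt h₄
    have := (backward_le_lineWeight le_rfl hrq).trans_lt h₁
    tauto
  · rcases le_total r t with h | h
    · exact (reach hl hk (lineWeight_lt_top_of_between (b := t) h₃ (by simp) hrq.le h)).symm
    · exact reach hk hl (lineWeight_lt_top_of_between (b := r) h₁ (by simp) htq.le h)

theorem exists_coversEdge [NeZero n] (hω : IsCycleNetwork ω) {K : Set (ZMod n)}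
    (hK : ω.pathCompletion.IsMinimalSourceDominating K) {k : ZMod n} (hk : k ∈ K) :
    ∃ e, ω.CoversEdge k e := by
  obtain ⟨s, rfl⟩ := ZMod.intCast_surjective k
  suffices H : ∃ q, q ≠ s ∧ ω.lineWeight s q < ∞ by
    obtain ⟨q, hne, hq⟩ := H
    rcases hne.lt_or_gt with h | h
    · exact ⟨_, coversEdge_of_between (b := s) hq (by simp) le_rfl h⟩
    · exact ⟨_, coversEdge_of_between (a := s) (by simp) hq le_rfl h⟩
  by_cases hfwd : ω.lineWeight s (s + 1) < ∞
  · exact ⟨s + 1, by omega, hfwd⟩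
  · have hbwd : ω.lineWeight (s + 1) s < ∞ := by
      have hxor := hω.oriented (s : ZMod n)
      rw [← Int.cast_one, ← Int.cast_add, Xor, ← lineWeight_add_one (ω := ω),
        ← lineWeight_add_one_left (ω := ω)] at hxor
      tauto
    -- The element dominating `s + 1` also reaches `s` and so is `s` itself. Thus `s` reaches some
    -- lift `q` of `s + 1`, and `q ≠ s` because `n` does not divide `1`.
    obtain ⟨l, hl, hls⟩ := hK.1 ((s + 1 : ℤ) : ZMod n)
    have h : l = s := hK.eq_of_lt_top hω hl hk
      (pathCompletion_lt_top_trans hω hls ((pathCompletion_le_lineWeight _ _).trans_lt hbwd))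
    subst h
    obtain ⟨q, hq, hle⟩ := exists_lineWeight_le_pathCompletion hω hls
    refine ⟨q, ?_, hle.trans_lt hls⟩
    rintro rfl
    obtain ⟨m, hm⟩ := intCast_eq_iff_exists.1 hq
    have h₁ : (n : ℤ) ∣ 1 := ⟨m, by omega⟩
    have h₂ := Int.le_of_dvd one_pos h₁
    have h₃ := hω.three_le
    omega

/-- With at least three elements in `K`, each of them reaches at most `n - 1` vertices along the line. -/
theorem sub_le_of_lineWeight_lt_top [NeZero n] (hω : IsCycleNetwork ω) {K : Set (ZMod n)}
    (hK : ω.pathCompletion.IsMinimalSourceDominating K) (hK3 : 3 ≤ K.ncard) {s a b : ℤ}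
    (hs : (s : ZMod n) ∈ K) (ha : ω.lineWeight s a < ∞) (hb : ω.lineWeight s b < ∞) :
    b - a ≤ n - 2 := by
  obtain ⟨k, l, hk, hl, hks, hls, hkl⟩ : ∃ k l, k ∈ K ∧ l ∈ K ∧ k ≠ s ∧ l ≠ s ∧ k ≠ l := by
    obtain ⟨x, y, z, hx, hy, hz, hxy, hxz, hyz⟩ := (Set.two_lt_ncard_iff K.toFinite).1 hK3
    grind
  by_contra! hab
  -- If `b - a ≥ n - 1`, then `s` covers the edges at `a, …, a + n - 2`. One edge is left, and two
  -- further elements of `K` would have to share it.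
  have key {j e : ZMod n} (hj : j ∈ K) (hjs : j ≠ s) (hje : ω.CoversEdge j e) :
      e = ((a + n - 1 : ℤ) : ZMod n) := by
    obtain ⟨p, hp₁, hp₂, rfl⟩ := exists_intCast_eq_of_le a e
    rcases lt_or_ge p b with hpb | hpb
    · exact absurd (eq_of_coversEdge hω hK hj hs hje (coversEdge_of_between ha hb hp₁ hpb)) hjs
    · congr 1
      omega
  obtain ⟨e, he⟩ := exists_coversEdge hω hK hk
  obtain ⟨f, hf⟩ := exists_coversEdge hω hK hl
  obtain rfl : e = f := (key hk hks he).trans (key hl hls hf).symm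
  exact hkl (eq_of_coversEdge hω hK hk hl he hf)

theorem not_lt_of_lineWeight_lt_top [NeZero n] (hω : IsCycleNetwork ω) {K : Set (ZMod n)}
    (hK : ω.pathCompletion.IsMinimalSourceDominating K) (hK3 : 3 ≤ K.ncard) {s t a b c d : ℤ}
    (hs : (s : ZMod n) ∈ K) (ht : (t : ZMod n) ∈ K) (hst : (s : ZMod n) ≠ t)
    (ha : ω.lineWeight s a < ∞) (hb : ω.lineWeight s b < ∞) (hc : ω.lineWeight t c < ∞)
    (hd : ω.lineWeight t d < ∞) (hac : (a : ZMod n) = c) (hbd : (b : ZMod n) = d) :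
    ¬ a < b := by
  intro hab
  have h₁ := sub_le_of_lineWeight_lt_top hω hK hK3 hs ha hb
  have h₂ := sub_le_of_lineWeight_lt_top hω hK hK3 ht hc hd
  have h₃ := sub_le_of_lineWeight_lt_top hω hK hK3 ht hd hc
  obtain ⟨m, rfl⟩ := intCast_eq_iff_exists.1 hac
  obtain ⟨m', rfl⟩ := intCast_eq_iff_exists.1 hbd
  have hn : (0 : ℤ) < n := by exact_mod_cast NeZero.pos n
  -- The sign tells whether `t` joins the two shared vertices along the other side of the cycle or
  -- along the same side as `s`. In the first case `s` and `t` together cover every edge, leaving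
  -- none for a third element; in the second they share the edge at `a`.
  rcases lt_or_ge (m' - m) 0 with hm | hm
  · obtain ⟨j, hj, hjs, hjt⟩ : ∃ j ∈ K, j ≠ s ∧ j ≠ t := by
      obtain ⟨x, y, z, hx, hy, hz, hxy, hxz, hyz⟩ := (Set.two_lt_ncard_iff K.toFinite).1 hK3
      grind
    obtain ⟨e, he⟩ := exists_coversEdge hω hK hj
    obtain ⟨p, hp₁, hp₂, rfl⟩ := exists_intCast_eq_of_le a e
    rcases lt_or_ge p b with hpb | hpb
    · exact hjs (eq_of_coversEdge hω hK hj hs he (coversEdge_of_between ha hb hp₁ hpb))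
    · have hmn : (n : ℤ) * (m' - m + 1) ≤ 0 := mul_nonpos_of_nonneg_of_nonpos hn.le (by omega)
      have hcov := coversEdge_of_between (p := p + n * (m - 1)) hd hc (by linarith) (by linarith)
      have hp : ((p + n * (m - 1) : ℤ) : ZMod n) = p := by simp
      rw [hp] at hcov
      exact hjt (eq_of_coversEdge hω hK hj ht he hcov)
  · have hmn : (0 : ℤ) ≤ n * (m' - m) := mul_nonneg hn.le hm
    have hcov := coversEdge_of_between (p := a + n * m) hc hd le_rfl (by linarith)
    rw [← hac] at hcov
    exact hst (eq_of_coversEdge hω hK hs ht (coversEdge_of_between ha hb le_rfl hab) hcov)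

/-! ### The arcs reached from a minimal dominating set. -/

open Classical in
/-- The coordinate of `x` on the line, near that of `k`, if `k` reaches `x`. -/
def reachLift (ω : Network (ZMod n)) (k x : ZMod n) : ℤ :=
  if h : ∃ q : ℤ, (q : ZMod n) = x ∧ ω.lineWeight k.cast q < ∞ then h.choose else 0

theorem reachLift_spec [NeZero n] (hω : IsCycleNetwork ω) {k x : ZMod n}
    (h : ω.pathCompletion k x < ∞) : (ω.reachLift k x : ZMod n) = x ∧
      ω.lineWeight k.cast (ω.reachLift k x) < ∞ := by
  have h' : ∃ q : ℤ, (q : ZMod n) = x ∧ ω.lineWeight k.cast q < ∞ := by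
    rw [← ZMod.intCast_zmod_cast k] at h
    obtain ⟨q, hq, hle⟩ := exists_lineWeight_le_pathCompletion hω h
    exact ⟨q, hq, hle.trans_lt h⟩
  rw [reachLift, dif_pos h']
  exact h'.choose_spec

/-- Two reached lifts of one vertex differ by a multiple of `n` but by at most `n - 2`, so the
choice in `reachLift` is forced. -/
theorem reachLift_intCast [NeZero n] (hω : IsCycleNetwork ω) {K : Set (ZMod n)}
    (hK : ω.pathCompletion.IsMinimalSourceDominating K) (hK3 : 3 ≤ K.ncard) {k : ZMod n}
    (hk : k ∈ K) {q : ℤ} (hq : ω.lineWeight k.cast q < ∞) : ω.reachLift k q = q := by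
  have h := (pathCompletion_le_lineWeight _ q).trans_lt hq
  rw [ZMod.intCast_zmod_cast] at h
  obtain ⟨h₁, h₂⟩ := reachLift_spec hω h
  have hk' : ((k.cast : ℤ) : ZMod n) ∈ K := by rwa [ZMod.intCast_zmod_cast]
  have h₃ := sub_le_of_lineWeight_lt_top hω hK hK3 hk' hq h₂
  have h₄ := sub_le_of_lineWeight_lt_top hω hK hK3 hk' h₂ hq
  rw [ZMod.intCast_eq_intCast_iff_dvd_sub] at h₁
  have := Int.eq_zero_of_abs_lt_dvd h₁ (abs_lt.2 ⟨by omega, by omega⟩)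
  omega

/-- The arcs of vertices that are reached by the elements of a minimal dominating set. -/
def reachArcs [NeZero n] (hω : IsCycleNetwork ω) {K : Set (ZMod n)}
    (hK : ω.pathCompletion.IsMinimalSourceDominating K) (hK3 : 3 ≤ K.ncard) :
    ArcSystem n K where
  arc k := {x | ω.pathCompletion k x < ∞}
  lift k x := ω.reachLift k x
  lift_cast k x hx := (reachLift_spec hω hx).1
  lift_add_one k x hx hx' := by
    obtain ⟨h₁, h₂⟩ := reachLift_spec hω hx
    obtain ⟨h₃, h₄⟩ := reachLift_spec hω hx'
    have hk' : ((k.1.cast : ℤ) : ZMod n) ∈ K := by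
      rw [ZMod.intCast_zmod_cast]
      exact k.2
    have h₅ := sub_le_of_lineWeight_lt_top hω hK hK3 hk' h₂ h₄
    have h₆ := sub_le_of_lineWeight_lt_top hω hK hK3 hk' h₄ h₂
    have h₇ : ((ω.reachLift k x + 1 : ℤ) : ZMod n) = ω.reachLift k (x + 1) := by
      rw [h₃, Int.cast_add, h₁, Int.cast_one]
    rw [ZMod.intCast_eq_intCast_iff_dvd_sub] at h₇
    have := Int.eq_zero_of_abs_lt_dvd h₇ (abs_lt.2 ⟨by omega, by omega⟩)
    omega
  eq_of_mem k l x y hxy hkx hky hlx hly := by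
    by_contra hne
    have hk := ZMod.intCast_zmod_cast k.1
    have hl := ZMod.intCast_zmod_cast l.1
    have hne' : ((k.1.cast : ℤ) : ZMod n) ≠ (l.1.cast : ℤ) := by
      rw [hk, hl]
      exact fun h => hne (Subtype.ext h)
    obtain ⟨h₁, h₂⟩ := reachLift_spec hω hkx
    obtain ⟨h₃, h₄⟩ := reachLift_spec hω hky
    obtain ⟨h₅, h₆⟩ := reachLift_spec hω hlx
    obtain ⟨h₇, h₈⟩ := reachLift_spec hω hly
    have hkK := hk.symm ▸ k.2
    have hlK := hl.symm ▸ l.2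
    have h₉ := not_lt_of_lineWeight_lt_top hω hK hK3 hkK hlK hne' h₂ h₄ h₆ h₈
      (h₁.trans h₅.symm) (h₃.trans h₇.symm)
    have h₁₀ := not_lt_of_lineWeight_lt_top hω hK hK3 hkK hlK hne' h₄ h₂ h₈ h₆
      (h₃.trans h₇.symm) (h₁.trans h₅.symm)
    refine hxy ?_
    rw [← h₁, ← h₃, le_antisymm (not_lt.1 h₁₀) (not_lt.1 h₉)]

/-- A ball around a vertex that is reached by `k ∈ K` is an interval in the coordinate of `k`. -/
theorem exists_lineWeight_reachLift_le [NeZero n] (hω : IsCycleNetwork ω) {K : Set (ZMod n)}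
    (hK : ω.pathCompletion.IsMinimalSourceDominating K) (hK3 : 3 ≤ K.ncard) (y : ZMod n) :
    ∃ k ∈ K, ∃ r : ℤ, (r : ZMod n) = y ∧ ∀ x, ω.pathCompletion y x < ∞ →
      ω.pathCompletion k x < ∞ ∧ (ω.reachLift k x : ZMod n) = x ∧
        ω.lineWeight r (ω.reachLift k x) ≤ ω.pathCompletion y x := by
  obtain ⟨k, hk, hky⟩ := hK.1 y
  obtain ⟨h₁, h₂⟩ := reachLift_spec hω hky
  refine ⟨k, hk, ω.reachLift k y, h₁, fun x hx => ?_⟩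
  have hkx := pathCompletion_lt_top_trans hω hky hx
  refine ⟨hkx, (reachLift_spec hω hkx).1, ?_⟩
  have hx' := hx
  rw [← h₁] at hx'
  -- The end `a` of a cheapest straight path from the coordinate of `y` is reached from `k` through
  -- that coordinate, so uniqueness makes it the coordinate of `x`.
  obtain ⟨a, rfl, ha⟩ := exists_lineWeight_le_pathCompletion hω hx'
  rw [h₁] at ha
  rwa [reachLift_intCast hω hK hK3 hk]
  exact (lineWeight_triangle _ _ a).trans_lt (ENNReal.add_lt_top.2 ⟨h₂, ha.trans_lt hx⟩)

/-! ### Faces and edges of the Dowker filtration. -/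

theorem carries_dowkerFiltration [NeZero n] (hω : IsCycleNetwork ω) {K : Set (ZMod n)}
    (hK : ω.pathCompletion.IsMinimalSourceDominating K) (hK3 : 3 ≤ K.ncard) (δ : ℝ≥0) :
    (reachArcs hω hK hK3).Carries (dowkerFiltration ω δ) := by
  classical
  rintro σ ⟨⟨x₀, hx₀⟩, y, hy⟩
  obtain ⟨k, hk, r, rfl, hr⟩ := exists_lineWeight_reachLift_le hω hK hK3 y
  have hδ {x : ZMod n} (h : ω.pathCompletion r x ≤ δ) := hr x (h.trans_lt ENNReal.coe_lt_top)
  -- The whole ball around the witness of `σ`; unlike `σ`, it is convex.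
  let τ := Finset.univ.filter fun x => ω.pathCompletion r x ≤ δ
  have hτ {x : ZMod n} : x ∈ τ ↔ ω.pathCompletion r x ≤ δ := by simp [τ]
  refine ⟨⟨k, hk⟩, τ, ⟨⟨x₀, hτ.2 (hy x₀ hx₀)⟩, r, fun x hx => hτ.1 hx⟩,
    fun x hx => hτ.2 (hy x hx), fun x hx => (hδ (hτ.1 hx)).1, fun u hu v hv p hup hpv => ?_⟩
  rw [hτ] at hu hv ⊢
  exact (pathCompletion_le_lineWeight r p).trans (lineWeight_le_of_between
    ((hδ hu).2.2.trans hu) ((hδ hv).2.2.trans hv) hup hpv)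

theorem exists_edge_mem_dowkerFiltration {δ : ℝ≥0} (hδ : maxEdgeWeight ω ≤ δ) (i : ZMod n) :
    ∃ σ ∈ dowkerFiltration ω δ, i ∈ σ ∧ i + 1 ∈ σ := by
  classical
  refine ⟨{i, i + 1}, ⟨⟨i, by simp⟩, ?_⟩, by simp, by simp⟩
  obtain ⟨p, rfl⟩ := ZMod.intCast_surjective i
  have h₀ (q : ℤ) : ω.pathCompletion (q : ZMod n) q ≤ δ :=
    (pathCompletion_le_lineWeight q q).trans (by simp)
  have h := (le_iSup (fun i : ZMod n => min (ω i (i + 1)) (ω (i + 1) i)) p).trans hδ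
  rw [← Int.cast_one, ← Int.cast_add] at h ⊢
  simp only [Finset.mem_insert, Finset.mem_singleton]
  rcases min_le_iff.1 h with h | h
  · refine ⟨p, ?_⟩
    rintro x (rfl | rfl)
    · exact h₀ p
    · exact (pathCompletion_le_lineWeight _ _).trans ((lineWeight_add_one p).trans_le h)
  · refine ⟨((p + 1 : ℤ) : ZMod n), ?_⟩
    rintro x (rfl | rfl)
    · exact (pathCompletion_le_lineWeight _ _).trans ((lineWeight_add_one_left p).trans_le h)
    · exact h₀ (p + 1)

/-- Take an edge heavier than `δ`. In the coordinate of some `k ∈ K` its ends are consecutive, so a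
centre near both would have to traverse it on the way to the farther end. -/
theorem exists_edge_not_mem_dowkerFiltration [NeZero n] (hω : IsCycleNetwork ω)
    {K : Set (ZMod n)} (hK : ω.pathCompletion.IsMinimalSourceDominating K) (hK3 : 3 ≤ K.ncard)
    {δ : ℝ≥0} (hδ : δ < maxEdgeWeight ω) :
    ∃ i : ZMod n, ¬ ∃ σ ∈ dowkerFiltration ω δ, i ∈ σ ∧ i + 1 ∈ σ := by
  obtain ⟨i, hi⟩ := lt_iSup_iff.1 hδ
  obtain ⟨hfwd, hbwd⟩ := lt_min_iff.1 hi
  refine ⟨i, ?_⟩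
  rintro ⟨σ, ⟨-, y, hy⟩, hiσ, hiσ'⟩
  have h₁ := hy i hiσ
  have h₂ := hy (i + 1) hiσ'
  obtain ⟨k, hk, r, -, hr⟩ := exists_lineWeight_reachLift_le hω hK hK3 y
  obtain ⟨h₃, h₄, h₅⟩ := hr i (h₁.trans_lt ENNReal.coe_lt_top)
  obtain ⟨h₆, h₇, h₈⟩ := hr (i + 1) (h₂.trans_lt ENNReal.coe_lt_top)
  have h₉ : ω.reachLift k (i + 1) = ω.reachLift k i + 1 :=
    (reachArcs hω hK hK3).lift_add_one ⟨k, hk⟩ i h₃ h₆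
  have h₁₀ : ((ω.reachLift k i + 1 : ℤ) : ZMod n) = i + 1 := by rw [← h₉, h₇]
  rcases le_or_gt r (ω.reachLift k i) with h | h
  · have h' := forward_le_lineWeight (ω := ω) (q := ω.reachLift k (i + 1)) h (by omega)
    rw [h₄, h₁₀] at h'
    exact (h'.trans (h₈.trans h₂)).not_gt hfwd
  · have h' := backward_le_lineWeight (ω := ω) le_rfl h
    rw [h₄, h₁₀] at h'
    exact (h'.trans (h₅.trans h₁)).not_gt hbwd

end Network

end

theorem mainTheorem5 {n : ℕ} (ω : Network (ZMod n)) (hω : IsInconsistentCycle ω)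
    (K : Set (ZMod n)) (hK : ω.pathCompletion.IsMinimalSourceDominating K) (hK3 : 3 ≤ K.ncard)
    (R : Type*) [CommRing R] :
    (∀ δ : ℝ≥0, maxEdgeWeight ω ≤ δ →
      Nonempty (SimplicialChains.H₁ R (dowkerFiltration ω δ) ≃ₗ[R] R)) ∧
    (∀ δ : ℝ≥0, (δ : ℝ≥0∞) < maxEdgeWeight ω →
      Subsingleton (SimplicialChains.H₁ R (dowkerFiltration ω δ))) ∧
    (∀ (δ δ' : ℝ≥0) (h : δ ≤ δ'), maxEdgeWeight ω ≤ δ →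
      Function.Bijective
        (SimplicialChains.H₁map R (dowkerFiltration_mono ω h))) := by
  have hc := hω.toIsCycleNetwork
  have : NeZero n := ⟨by have := hc.three_le; omega⟩
  have hD := Network.carries_dowkerFiltration hc hK hK3
  have hbij (δ : ℝ≥0) (hδ : maxEdgeWeight ω ≤ δ) :
      Function.Bijective (ArcSystem.winding R (hD δ)) :=
    ⟨ArcSystem.winding_injective R (hD δ), ArcSystem.winding_surjective R (hD δ)
      (Network.exists_edge_mem_dowkerFiltration hδ)⟩
  refine ⟨fun δ hδ => ⟨LinearEquiv.ofBijective _ (hbij δ hδ)⟩, fun δ hδ => ?_,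
    fun δ δ' h hδ => ?_⟩
  · obtain ⟨i, hi⟩ := Network.exists_edge_not_mem_dowkerFiltration hc hK hK3 hδ
    exact ArcSystem.subsingleton_H₁ R (hD δ) hi
  · have hδ' : maxEdgeWeight ω ≤ δ' := hδ.trans (ENNReal.coe_le_coe.2 h)
    -- Both winding maps are bijective and commute with the inclusion, so the induced map is
    -- bijective.
    refine (Function.Bijective.of_comp_iff' (hbij δ' hδ') _).1 ?_
    convert hbij δ hδ using 1
    exact funext (ArcSystem.winding_H₁map R (hD δ) (hD δ') _)
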